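/- Let $n\ge 1$ and write $[n]=\{1,\dots,n\}$. A code on $[n]$ is a collection $\mathcal C\subseteq 2^{[n]}$ of subsets of $[n]$, called codewords; it is intersection complete if the intersection of any two codewords is again a codeword. The code of a family $U_1,\dots,U_n$ of subsets of $\mathbb R^d$ consists of all $\sigma\subseteq[n]$ for which $\bigcap_{i\in\sigma}U_i\setminus\bigcup_{j\in[n]\setminus\sigma}U_j\neq\emptyset$, where the intersection over $\sigma=\emptyset$ is $\mathbb R^d$. The open embedding dimension $\operatorname{odim}(\mathcal C)$ is the smallest $d\ge 0$ such that $\mathcal C$ is the code of a family of (possibly empty) convex open subsets of $\mathbb R^d$, or $\infty$ if no such $d$ exists. Let $\Delta(\mathcal C)$ be the smallest family of subsets of $[n]$ that contains $\mathcal C$ and is closed under taking subsets, and let $\dim\Delta(\mathcal C)$ be one less than the size of its largest member. Finally, let $\mathcal D$ be the set of all codewords of $\mathcal C$ that are either empty or minimal (under inclusion) among the nonempty codewords of $\mathcal C$, and define the code \[ \mathcal S_{\mathcal C/\min}:=\mathcal C\cup\{[n]\}\cup\{d\cup\{n+1\}\mid d\in\mathcal D\}\subseteq 2^{[n+1]}.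 \] If $\mathcal C\subseteq 2^{[n]}$ is intersection complete and contains every singleton $\{i\}$, $i\in[n]$, then \[ \operatorname{odim}(\mathcal S_{\mathcal C/\min})\ \ge\ \left\lceil\frac{n}{\dim(\Delta(\mathcal C))+1}\right\rceil . \] -/

import Mathlib

/-- A combinatorial code on the neurons `[n]`: a collection of subsets of an `n`-element set.
Its members are called codewords. -/
abbrev Code (n : ℕ) : Type := Set (Finset (Fin n))

namespace Code

/-- The intersection of any two codewords is again a codeword. -/
def IntersectionComplete {n : ℕ} (C : Code n) : Prop :=
  ∀ c ∈ C, ∀ d ∈ C, c ∩ d ∈ C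

/-- The atom of `σ`: the points lying in `U i` for all `i ∈ σ` and in no other `U j`. The
intersection over the empty set is the whole ambient space `X`. -/
def atom {n : ℕ} {X : Type*} (U : Fin n → Set X) (σ : Finset (Fin n)) : Set X :=
  (⋂ i ∈ σ, U i) \ ⋃ j ∉ σ, U j

/-- The code of the family `U` in the ambient space `X`. -/
def ofFamily {n : ℕ} {X : Type*} (U : Fin n → Set X) : Code n :=
  {σ | (atom U σ).Nonempty}

/-- `C` has a realization in `ℝ^d` by (possibly empty) convex open sets. -/
def HasOpenConvexRealization {n : ℕ} (C : Code n) (d : ℕ) : Prop :=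
  ∃ U : Fin n → Set (EuclideanSpace ℝ (Fin d)),
    (∀ i, IsOpen (U i)) ∧ (∀ i, Convex ℝ (U i)) ∧ ofFamily U = C

/-- The open embedding dimension: the least `d` such that `C` has an open convex realization in
`ℝ^d`, and `⊤` if there is none. -/
noncomputable def odim {n : ℕ} (C : Code n) : ℕ∞ :=
  sInf {e : ℕ∞ | ∃ d : ℕ, (d : ℕ∞) = e ∧ C.HasOpenConvexRealization d}

/-- The simplicial complex of `C`: the smallest family of subsets of `[n]` that contains `C` and is
closed under taking subsets. -/
def complex {n : ℕ} (C : Code n) : LowerSet (Finset (Fin n)) :=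
  lowerClosure C

/-- The code `S_{C/D}` on `n + 1` neurons, with codewords those of `C`, the full set `[n]`, and
`d ∪ {n + 1}` for `d ∈ D`. The set `[n]` is identified with its image under `Fin.castSucc`, and the
neuron `n + 1` is `Fin.last n`. -/
def gluedSunflower {n : ℕ} (C D : Code n) : Code (n + 1) :=
  {σ | (∃ c ∈ C, σ = c.map Fin.castSuccEmb) ∨
    σ = (Finset.univ : Finset (Fin n)).map Fin.castSuccEmb ∨
    ∃ d ∈ D, σ = insert (Fin.last n) (d.map Fin.castSuccEmb)}

/-- The minimal nonempty codewords of `C`, together with the empty codeword if it lies in `C` (by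
convention codes contain the empty set, and it is needed for this set of codewords to be
intersection complete). -/
def minWords {n : ℕ} (C : Code n) : Code n :=
  {d | d ∈ C ∧ (d = ∅ ∨ Minimal (fun c => c ∈ C ∧ c.Nonempty) d)}

/-- The code `S_{C/min}`. -/
def gluedSunflowerMin {n : ℕ} (C : Code n) : Code (n + 1) :=
  C.gluedSunflower C.minWords

end Code

/-- The dimension of a simplicial complex on `[n]`: one less than the size of its largest face.
(The supremum is over a finite set of natural numbers.) -/
noncomputable def complexDim {n : ℕ} (Δ : LowerSet (Finset (Fin n))) : ℤ :=
  ((sSup {m : ℕ | ∃ σ ∈ Δ, σ.card = m} : ℕ) : ℤ) - 1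

/-!
Put `k = dim Δ(C) + 1`, the largest size of a face, and suppose that convex open sets in `ℝ^d`
realize `S_{C/min}` although `n > d * k`. Let `K` be the intersection of the first `n` sets, which
is nonempty. A point lying in more than `k` of the first `n` sets has a codeword that can only be
the full set `[n]`, so it lies in `K` (a *`k`-flexible sunflower* with center `K`). The last set
meets each of the first `n`, because singletons are minimal nonempty codewords, but misses `K`.

This is contradictory by `exists_mem_inter_of_flexible`: if a convex open set `V` meets every
member of a `k`-flexible sunflower of more than `d * k` convex open sets, then it meets the center
`K`. Otherwise some hyperplane separates `V` from `K`, and a parallel one `H`, a little further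
away from `K`, contains a point `q i` of every `U i`: take a segment from `V ∩ U i` to a point of
`K`. Since `H` has dimension `d - 1`, Helly's theorem gives a centerpoint `w ∈ H`
(`exists_centerpoint`): every open half-space containing `w` contains more than `k` of the `q i`.
Now let a closed ball in `K` shrink homothetically towards `w ∉ closure K`. At the moment when it
stops being contained in `K`, it touches the complement at a point `u`, and `w` lies strictly
beyond the tangent hyperplane at `u` (`exists_tangent_point`). Hence more than `k` of the `q i` do.
For such `i` the ray from `q i` through `u` goes on into the ball, hence into `K ⊆ U i`, so
`u ∈ U i` by convexity. Flexibility then gives `u ∈ K`, a contradiction.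
-/

/-! ### Centerpoints -/

/-- The centerpoint theorem, in the form that `w` survives the removal of any `k` of the points:
equivalently, every open half-space containing `w` contains more than `k` of them. -/
theorem exists_centerpoint {E : Type*} [AddCommGroup E] [Module ℝ E] [FiniteDimensional ℝ E]
    {n k : ℕ} (v : Fin n → E) (h : (Module.finrank ℝ E + 1) * k < n) :
    ∃ w : E, ∀ S : Finset (Fin n), S.card ≤ k → w ∈ convexHull ℝ (v '' {i | i ∉ S}) := by
  classical
  obtain ⟨w, hw⟩ := Convex.helly_theorem' (𝕜 := ℝ)
    (F := fun S : Finset (Fin n) => convexHull ℝ (v '' {i | i ∉ S}))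
    (s := Finset.univ.filter fun S : Finset (Fin n) => S.card ≤ k)
    (fun S _ => convex_convexHull ℝ _) (by
      intro I hI hcard
      -- The sets indexed by `I` have too small a union to exhaust the `n` indices.
      have hlt : (I.biUnion id).card < (Finset.univ : Finset (Fin n)).card := by
        calc (I.biUnion id).card ≤ I.card * k :=
              Finset.card_biUnion_le_card_mul _ _ _ fun S hS => by
                simpa using (Finset.mem_filter.mp (hI hS)).2
          _ ≤ (Module.finrank ℝ E + 1) * k := Nat.mul_le_mul_right _ hcard
          _ < _ := by simpa using h
      obtain ⟨i, -, hi⟩ := Finset.exists_mem_notMem_of_card_lt_card hlt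
      refine ⟨v i, Set.mem_iInter₂.mpr fun S hS => subset_convexHull ℝ _ ⟨i, ?_, rfl⟩⟩
      exact fun hiS => hi (Finset.mem_biUnion.mpr ⟨S, hS, hiS⟩))
  refine ⟨w, fun S hS => ?_⟩
  exact Set.mem_iInter₂.mp hw S (by simpa using hS)

/-! ### Balls touching the boundary of an open set -/

/-- A ball in the open set `U` that shrinks homothetically towards `w ∉ closure U` touches the
complement of `U` in a point `u`. The last property says that `u` lies on the segment from `w` to
a point of `U`, namely the point of the initial ball that has moved to `u`. -/
theorem exists_touching_ball {E : Type*} [NormedAddCommGroup E] [NormedSpace ℝ E]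
    [ProperSpace E] {U : Set E} (hU : IsOpen U) (hne : U.Nonempty) {w : E}
    (hw : w ∉ closure U) :
    ∃ z u : E, u ≠ z ∧ u ∉ U ∧ Metric.ball z (dist u z) ⊆ U ∧
      ∃ t : ℝ, 0 < t ∧ u + t • (u - w) ∈ U := by
  obtain ⟨c, hc⟩ := hne
  obtain ⟨r, hr, hrU⟩ := Metric.nhds_basis_closedBall.mem_iff.mp (hU.mem_nhds hc)
  set T : Set (ℝ × E) := (Set.Icc 0 1 ×ˢ Metric.closedBall c r) ∩
    {p | w + p.1 • (p.2 - w) ∉ U} with hT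
  have hcont : Continuous fun p : ℝ × E => w + p.1 • (p.2 - w) := by fun_prop
  have hTc : IsCompact T :=
    (isCompact_Icc.prod (isCompact_closedBall c r)).inter_right
      (hU.isClosed_compl.preimage hcont)
  -- Balls of sufficiently small positive ratio leave `U`.
  obtain ⟨s₀, hs₀, hs₀T⟩ : ∃ s : ℝ, 0 < s ∧ (s, c) ∈ T := by
    have hcs : Continuous fun s : ℝ => w + s • (c - w) := by fun_prop
    have h0 : ∀ᶠ s in nhds (0 : ℝ), w + s • (c - w) ∈ (closure U)ᶜ :=
      hcs.continuousAt.eventually_mem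
        (isClosed_closure.isOpen_compl.mem_nhds (by simpa using hw))
    obtain ⟨s, ⟨hs1, hs2⟩, hs3⟩ :=
      ((h0.filter_mono nhdsWithin_le_nhds).and (Ioo_mem_nhdsGT (zero_lt_one' ℝ))).exists.imp
        fun s hs => And.intro hs.2 hs.1
    exact ⟨s, hs1, ⟨⟨hs1.le, hs2.le⟩, by simp [hr.le]⟩, fun h => hs3 (subset_closure h)⟩
  obtain ⟨⟨s, x⟩, hsx, hmax⟩ := hTc.exists_isMaxOn ⟨_, hs₀T⟩ continuous_fst.continuousOn
  obtain ⟨⟨⟨-, hs1⟩, hx⟩, hu⟩ := hsx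
  simp only at hs1 hx
  simp only [Set.mem_ofPred_eq] at hu
  have hs : 0 < s := hs₀.trans_le (hmax hs₀T)
  have hs1' : s < 1 := by
    refine lt_of_le_of_ne hs1 fun h => hu ?_
    subst h
    simpa using hrU hx
  -- By maximality of `s`, the open ball of ratio `s` is still inside `U`.
  have hin : ∀ y ∈ Metric.ball c r, w + s • (y - w) ∈ U := by
    intro y hy
    have hcs : ContinuousAt (fun a : ℝ => w + (s / a) • (y - w)) s := by
      have : ContinuousAt (fun a : ℝ => s / a) s := continuousAt_const.div continuousAt_id hs.ne'
      fun_prop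
    have hev : ∀ᶠ a in nhds s, w + (s / a) • (y - w) ∈ Metric.ball c r :=
      hcs.eventually_mem (Metric.isOpen_ball.mem_nhds (by simpa [div_self hs.ne'] using hy))
    obtain ⟨a, ha, ⟨hsa, ha1⟩⟩ :=
      ((hev.filter_mono nhdsWithin_le_nhds).and (Ioo_mem_nhdsGT hs1')).exists
    by_contra hcon
    have ha0 : a ≠ 0 := (hs.trans hsa).ne'
    have : (a, w + (s / a) • (y - w)) ∈ T := by
      refine ⟨⟨⟨(hs.trans hsa).le, ha1.le⟩, Metric.ball_subset_closedBall ha⟩, ?_⟩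
      simpa [smul_smul, mul_div_cancel₀ s ha0] using hcon
    exact absurd (hmax this) (not_le.mpr hsa)
  have hxr : dist x c = r := by
    refine le_antisymm hx (not_lt.mp fun h => hu (hin x h))
  have hd : ∀ y, dist (w + s • (y - w)) (w + s • (c - w)) = s * dist y c := by
    intro y
    rw [dist_add_left, dist_smul₀, dist_sub_right, Real.norm_of_nonneg hs.le]
  refine ⟨w + s • (c - w), w + s • (x - w), ?_, hu, ?_, s⁻¹ - 1, ?_, ?_⟩
  · rw [← dist_pos, hd, hxr]
    positivity
  · intro y hy
    have hy' : w + s • ((w + s⁻¹ • (y - w)) - w) = y := by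
      simp [smul_smul, mul_inv_cancel₀ hs.ne']
    rw [← hy'] at hy ⊢
    rw [Metric.mem_ball, hd, hd, hxr] at hy
    exact hin _ (lt_of_mul_lt_mul_left hy hs.le)
  · exact sub_pos.mpr ((one_lt_inv₀ hs).mpr hs1')
  · have : w + s • (x - w) + (s⁻¹ - 1) • (w + s • (x - w) - w) = x := by
      rw [add_sub_cancel_left, smul_smul, sub_mul, inv_mul_cancel₀ hs.ne', one_mul, sub_smul,
        one_smul]
      abel
    rw [this]
    exact hrU hx

/-- A convex set containing a point `q` and a point beyond `u` on the ray from `q` contains `u`. -/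
theorem Convex.mem_of_add_smul_sub_mem {E : Type*} [AddCommGroup E] [Module ℝ E] {U : Set E}
    (hU : Convex ℝ U) {q u : E} (hq : q ∈ U) {ε : ℝ} (hε : 0 < ε)
    (h : u + ε • (u - q) ∈ U) : u ∈ U := by
  have h1 : (1 + ε) ≠ 0 := by positivity
  have := hU h hq (a := (1 + ε)⁻¹) (b := ε / (1 + ε)) (by positivity) (by positivity)
    (by field_simp)
  have e : (1 + ε)⁻¹ • (u + ε • (u - q)) + (ε / (1 + ε)) • q = u := by
    match_scalars <;> field_simp
    ring
  rwa [e] at this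

/-- A point `w` outside the closure of a convex open set `U` lies strictly beyond some tangent
hyperplane of `U`, with normal `m` at a boundary point `u` where `U` contains a touching ball. The
ball guarantees that every line crossing the hyperplane at `u` enters `U` right behind `u`. -/
theorem exists_tangent_point {E : Type*} [NormedAddCommGroup E] [InnerProductSpace ℝ E]
    [ProperSpace E] {U : Set E} (hU : IsOpen U) (hconv : Convex ℝ U) (hne : U.Nonempty) {w : E}
    (hw : w ∉ closure U) :
    ∃ u m : E, u ∉ U ∧ 0 < inner ℝ m (w - u) ∧
      ∀ q : E, 0 < inner ℝ m (q - u) → ∃ ε : ℝ, 0 < ε ∧ u + ε • (u - q) ∈ U := by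
  obtain ⟨z, u, huz, hu, hball, t, ht, htU⟩ := exists_touching_ball hU hne hw
  have hm : 0 < ‖u - z‖ := norm_pos_iff.mpr (sub_ne_zero.mpr huz)
  have hray : ∀ q : E, 0 < inner ℝ (u - z) (q - u) → ∃ ε : ℝ, 0 < ε ∧ u + ε • (u - q) ∈ U := by
    intro q hq
    set a := inner ℝ (u - z) (q - u) with ha
    set b := ‖q - u‖ ^ 2 with hb
    have hb0 : 0 ≤ b := by positivity
    -- For this `ε` the first-order gain `2 * ε * a` exceeds the second-order term `ε ^ 2 * b`.
    refine ⟨a / (b + 1), by positivity, hball ?_⟩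
    set ε := a / (b + 1) with hε
    have hε0 : 0 < ε := by positivity
    have hεb : ε * b < 2 * a := by
      have : ε * (b + 1) = a := by rw [hε]; field_simp
      nlinarith
    have e : u + ε • (u - q) - z = (u - z) - ε • (q - u) := by
      rw [smul_sub, smul_sub]; abel
    rw [Metric.mem_ball, dist_eq_norm, dist_eq_norm, e]
    refine lt_of_pow_lt_pow_left₀ 2 hm.le ?_
    rw [norm_sub_sq_real, inner_smul_right, ← ha, norm_smul, mul_pow, ← hb,
      Real.norm_of_nonneg hε0.le]
    nlinarith
  -- Consequently no point of `U` lies strictly beyond the hyperplane; by openness, none on it.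
  have hle : ∀ x ∈ U, inner ℝ (u - z) (x - u) ≤ 0 := by
    intro x hx
    by_contra! hcon
    obtain ⟨ε, hε, h⟩ := hray x hcon
    exact hu (hconv.mem_of_add_smul_sub_mem hx hε h)
  have hlt : ∀ x ∈ U, inner ℝ (u - z) (x - u) < 0 := by
    intro x hx
    have hcs : Continuous fun a : ℝ => x + a • (u - z) := by fun_prop
    have hev : ∀ᶠ a in nhds (0 : ℝ), x + a • (u - z) ∈ U :=
      hcs.continuousAt.eventually_mem (hU.mem_nhds (by simpa using hx))
    obtain ⟨a, ha, ha0⟩ :=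
      ((hev.filter_mono nhdsWithin_le_nhds).and (self_mem_nhdsWithin (s := Set.Ioi 0))).exists
    have h := hle _ ha
    rw [add_sub_right_comm, inner_add_right, inner_smul_right, real_inner_self_eq_norm_sq] at h
    have : 0 < a * ‖u - z‖ ^ 2 := mul_pos ha0 (by positivity)
    linarith
  refine ⟨u, u - z, hu, ?_, hray⟩
  have h := hlt _ htU
  rw [add_sub_cancel_left, inner_smul_right, ← neg_sub w u, inner_neg_right] at h
  by_contra! hcon
  nlinarith

/-! ### Flexible sunflowers -/

/-- The flexible sunflower theorem: if points lying in more than `k` of the convex open sets `U i`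
lie in all of them, and there are more than `d * k` sets in dimension `d ≥ 1`, then a convex open
set that meets every `U i` meets the intersection of the `U i`, provided that is nonempty. -/
theorem exists_mem_inter_of_flexible {E : Type*} [NormedAddCommGroup E] [InnerProductSpace ℝ E]
    [FiniteDimensional ℝ E] {n k : ℕ} (hn : Module.finrank ℝ E * k < n)
    (U : Fin n → Set E) (hU : ∀ i, IsOpen (U i)) (hconv : ∀ i, Convex ℝ (U i))
    (hflex : ∀ (x : E) (S : Finset (Fin n)), k < S.card → (∀ i ∈ S, x ∈ U i) → ∀ i, x ∈ U i)
    (hne : (⋂ i, U i).Nonempty) {V : Set E} (hV : IsOpen V) (hVconv : Convex ℝ V)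
    (hVU : ∀ i, (V ∩ U i).Nonempty) :
    (V ∩ ⋂ i, U i).Nonempty := by
  classical
  have : ProperSpace E := FiniteDimensional.proper ℝ E
  by_contra hdis
  have hKo : IsOpen (⋂ i, U i) := isOpen_iInter_of_finite hU
  have hKc : Convex ℝ (⋂ i, U i) := convex_iInter hconv
  obtain ⟨f, a, hfV, hfK⟩ := geometric_hahn_banach_open_open hVconv hV hKc hKo
    (Set.disjoint_iff_inter_eq_empty.mpr (Set.not_nonempty_iff_eq_empty.mp hdis))
  obtain ⟨c, hc⟩ := hne
  choose p hpV hpU using hVU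
  let i₀ : Fin n := ⟨0, by omega⟩
  -- Below, `K` stands for the center `⋂ i, U i`. The hyperplane `f = b` separates the
  -- points `p i` from `K` and stays away from the closure of `K`.
  obtain ⟨b, hpb, hba⟩ : ∃ b, (∀ i, f (p i) < b) ∧ b < a := by
    have hs : (Finset.univ : Finset (Fin n)).Nonempty := ⟨i₀, Finset.mem_univ _⟩
    obtain ⟨j, -, hj⟩ := Finset.exists_max_image Finset.univ (fun i => f (p i)) hs
    obtain ⟨b, hb1, hb2⟩ := exists_between (hfV _ (hpV j))
    exact ⟨b, fun i => (hj i (Finset.mem_univ i)).trans_lt hb1, hb2⟩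
  have hbc : b < f c := hba.trans (hfK c hc)
  have hq : ∀ i, ∃ q ∈ U i, f q = b := by
    intro i
    have hpos : 0 < f c - f (p i) := by linarith [hpb i]
    refine ⟨p i + ((b - f (p i)) / (f c - f (p i))) • (c - p i),
      (hconv i).add_smul_sub_mem (hpU i) (Set.mem_iInter.mp hc i) ⟨?_, ?_⟩, ?_⟩
    · exact div_nonneg (by linarith [hpb i]) hpos.le
    · rw [div_le_one hpos]; linarith
    · rw [map_add, map_smul, map_sub, smul_eq_mul, div_mul_cancel₀ _ hpos.ne']; ring
  choose q hqU hqb using hq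
  have hf0 : (f : E →ₗ[ℝ] ℝ) ≠ 0 := by
    intro h
    have h1 : ∀ x, f x = 0 := fun x => LinearMap.congr_fun h x
    have := hpb i₀
    rw [h1] at this hbc
    linarith
  have hdim := Module.Dual.finrank_ker_add_one_of_ne_zero hf0
  -- The hyperplane is a translate of `ker f`, where centerpoints are one dimension cheaper.
  let v : Fin n → LinearMap.ker (f : E →ₗ[ℝ] ℝ) := fun i =>
    ⟨q i - q i₀, by simp [hqb]⟩
  obtain ⟨w, hw⟩ := exists_centerpoint (k := k) v (by rwa [hdim])
  have hwb : f (q i₀ + w) = b := by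
    have : f (w : E) = 0 := w.2
    rw [map_add, this, hqb, add_zero]
  have hwK : q i₀ + (w : E) ∉ closure (⋂ i, U i) := by
    intro h
    have : closure (⋂ i, U i) ⊆ {x | a ≤ f x} :=
      closure_minimal (fun x hx => (hfK x hx).le) (isClosed_le continuous_const f.continuous)
    have h2 : a ≤ f (q i₀ + w) := this h
    linarith
  obtain ⟨u, m, hu, hwm, hray⟩ := exists_tangent_point hKo hKc ⟨c, hc⟩ hwK
  refine hu (Set.mem_iInter.mpr
    (hflex u (Finset.univ.filter fun i => 0 < inner ℝ m (q i - u)) ?_ ?_))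
  · by_contra! hcard
    have hmem := hw _ hcard
    have hsub : convexHull ℝ (v '' {i | i ∉ Finset.univ.filter fun i => 0 < inner ℝ m (q i - u)}) ⊆
        {x | inner ℝ m (x : E) ≤ inner ℝ m (u - q i₀)} := by
      refine convexHull_min ?_ ?_
      · rintro _ ⟨i, hi, rfl⟩
        simp only [Set.mem_ofPred_eq, Finset.mem_filter, Finset.mem_univ, true_and, not_lt] at hi
        simp only [Set.mem_ofPred_eq, v, inner_sub_right] at hi ⊢
        linarith
      · exact convex_halfSpace_le
          ((innerₛₗ ℝ m).comp (LinearMap.ker (f : E →ₗ[ℝ] ℝ)).subtype).isLinear _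
    have := hsub hmem
    simp only [Set.mem_ofPred_eq, inner_sub_right] at this
    rw [inner_sub_right, inner_add_right] at hwm
    linarith
  · intro i hi
    obtain ⟨ε, hε, h⟩ := hray (q i) (Finset.mem_filter.mp hi).2
    exact (hconv i).mem_of_add_smul_sub_mem (hqU i) hε (Set.mem_iInter.mp h i)

/-! ### The embedding dimension of `S_{C/min}` -/

namespace Code

variable {n : ℕ}

/-- Every point `x` has a codeword, consisting of the indices of the sets that contain `x`. -/
theorem exists_mem_ofFamily {X : Type*} (U : Fin n → Set X) (x : X) :
    ∃ σ ∈ ofFamily U, ∀ i, i ∈ σ ↔ x ∈ U i := by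
  classical
  refine ⟨Finset.univ.filter fun i => x ∈ U i, ⟨x, ?_⟩, by simp⟩
  simp [atom]

theorem exists_forall_mem_iff {X : Type*} {U : Fin n → Set X} {σ : Finset (Fin n)}
    (h : σ ∈ ofFamily U) : ∃ x, ∀ i, i ∈ σ ↔ x ∈ U i := by
  obtain ⟨x, hx, hx'⟩ := h
  refine ⟨x, fun i => ⟨fun hi => Set.mem_iInter₂.mp hx i hi, fun hi => ?_⟩⟩
  by_contra hσ
  exact hx' (Set.mem_iUnion₂.mpr ⟨i, hσ, hi⟩)

theorem card_le_sSup_card_complex {C : Code n} {c : Finset (Fin n)} (hc : c ∈ C) :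
    c.card ≤ sSup {m : ℕ | ∃ σ ∈ C.complex, σ.card = m} := by
  refine le_csSup ⟨n, ?_⟩ ⟨c, subset_lowerClosure hc, rfl⟩
  rintro _ ⟨σ, -, rfl⟩
  simpa using σ.card_le_univ

theorem singleton_mem_minWords {C : Code n} {i : Fin n} (h : {i} ∈ C) : {i} ∈ C.minWords := by
  refine ⟨h, Or.inr ⟨⟨h, Finset.singleton_nonempty i⟩, ?_⟩⟩
  rintro c ⟨-, hc⟩ hle
  exact ((hc.subset_singleton_iff).mp hle).ge

/-- In a code with all singletons, `n` is at most `d` times any bound `k` on the sizes of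
codewords, for every `d` in which `S_{C/min}` has an open convex realization. -/
theorem le_mul_of_hasOpenConvexRealization {C : Code n} (hn : 1 ≤ n)
    (hsing : ∀ i : Fin n, {i} ∈ C) {k : ℕ} (hk : ∀ c ∈ C, c.card ≤ k) {d : ℕ}
    (h : C.gluedSunflowerMin.HasOpenConvexRealization d) : n ≤ d * k := by
  classical
  obtain ⟨U, hU, hconv, hcode⟩ := h
  by_contra! hlt
  have hpoint : ∀ i : Fin n, ∃ x, ∀ j, j ∈ insert (Fin.last n) (({i} : Finset (Fin n)).map
      Fin.castSuccEmb) ↔ x ∈ U j := by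
    intro i
    apply exists_forall_mem_iff
    rw [hcode]
    exact Or.inr (Or.inr ⟨_, singleton_mem_minWords (hsing i), rfl⟩)
  obtain ⟨c, hc⟩ : ∃ x, ∀ j, j ∈ (Finset.univ : Finset (Fin n)).map Fin.castSuccEmb ↔ x ∈ U j := by
    apply exists_forall_mem_iff
    rw [hcode]
    exact Or.inr (Or.inl rfl)
  have hcU : ∀ i : Fin n, c ∈ U i.castSucc := fun i => (hc _).mp (by simp)
  have hcl : c ∉ U (Fin.last n) := fun h => by simpa using (hc _).mpr h
  obtain rfl | hd := Nat.eq_zero_or_pos d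
  · -- The space `ℝ^0` has a single point, but `[n]` and `{1, n + 1}` are different codewords.
    obtain ⟨x, hx⟩ := hpoint ⟨0, hn⟩
    rw [Subsingleton.elim x c] at hx
    exact hcl ((hx _).mp (by simp))
  have hkn : k < n := lt_of_le_of_lt (Nat.le_mul_of_pos_left k hd) hlt
  obtain ⟨y, hyl, hy⟩ := exists_mem_inter_of_flexible (k := k) (by simpa using hlt)
    (fun i : Fin n => U i.castSucc) (fun i => hU _) (fun i => hconv _) (by
      intro x S hS hxS i
      obtain ⟨σ, hσ, hσx⟩ := exists_mem_ofFamily U x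
      rw [hcode] at hσ
      have hsmall : ∀ t ∈ C, ∃ j ∈ S, j ∉ t := fun t ht =>
        Finset.exists_mem_notMem_of_card_lt_card ((hk t ht).trans_lt hS)
      obtain ⟨t, ht, rfl⟩ | rfl | ⟨t, ht, rfl⟩ := hσ
      · obtain ⟨j, hj, hjt⟩ := hsmall t ht
        exact absurd ((hσx _).mpr (hxS j hj)) (by simpa using hjt)
      · exact (hσx _).mp (by simp)
      · obtain ⟨j, hj, hjt⟩ := hsmall t ht.1
        exact absurd ((hσx _).mpr (hxS j hj)) (by simpa using hjt))
    ⟨c, Set.mem_iInter.mpr hcU⟩ (hU (Fin.last n)) (hconv _) (by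
      intro i
      obtain ⟨x, hx⟩ := hpoint i
      exact ⟨x, (hx _).mp (by simp), (hx _).mp (by simp)⟩)
  rw [Set.mem_iInter] at hy
  obtain ⟨σ, hσ, hσy⟩ := exists_mem_ofFamily U y
  rw [hcode] at hσ
  have hlast : Fin.last n ∈ σ := (hσy _).mpr hyl
  obtain ⟨t, ht, rfl⟩ | rfl | ⟨t, ht, rfl⟩ := hσ
  · simp at hlast
  · simp at hlast
  · have htop : t = Finset.univ := Finset.eq_univ_iff_forall.mpr fun i => by
      simpa using (hσy _).mpr (hy i)
    have := hk t ht.1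
    rw [htop, Finset.card_univ, Fintype.card_fin] at this
    omega

end Code

theorem mainTheorem8 (n : ℕ) (hn : 1 ≤ n) (C : Code n) (hC : C.IntersectionComplete)
    (hsing : ∀ i : Fin n, {i} ∈ C) :
    ((⌈(n : ℚ) / ((complexDim C.complex : ℚ) + 1)⌉₊ : ℕ) : ℕ∞) ≤ C.gluedSunflowerMin.odim := by
  refine le_sInf ?_
  rintro _ ⟨d, rfl, hd⟩
  have hle := Code.le_mul_of_hasOpenConvexRealization hn hsing
    (fun c hc => Code.card_le_sSup_card_complex hc) hd
  have hpos : 0 < sSup {m : ℕ | ∃ σ ∈ C.complex, σ.card = m} :=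
    Nat.pos_of_mul_pos_left (lt_of_lt_of_le hn hle)
  rw [Nat.cast_le, Nat.ceil_le, complexDim]
  push_cast
  rw [sub_add_cancel, div_le_iff₀ (by exact_mod_cast hpos)]
  exact_mod_cast hle
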